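/- Let $\Lambda$ be a commutative ring (with identity), and let $n$ be a positive integer. The category $\operatorname{proj}\Lambda$ of finitely generated projective $\Lambda$-modules is $n$-abelian if and only if $\Lambda$ is von Neumann regular, that is, for every $x\in\Lambda$ there is $y\in\Lambda$ with $xyx=x$. Here an $n$-kernel of a morphism $f\colon X\to Y$ in a preadditive category $\mathcal C$ is a sequence $X_n\xrightarrow{f_n}\cdots\xrightarrow{f_2}X_1\xrightarrow{f_1}X$ in $\mathcal C$ such that for every object $W$ of $\mathcal C$ the sequence of abelian groups $$0\to\mathcal C(W,X_n)\to\cdots\to\mathcal C(W,X_1)\to\mathcal C(W,X)\to\mathcal C(W,Y)$$ is exact; an $n$-cokernel $Y\xrightarrow{g_1}Y_1\xrightarrow{g_2}\cdots\xrightarrow{g_n}Y_n$ of $f$ is defined dually. A preadditive category $\mathcal C$ is called $n$-abelian if it is additive (it has a zero object and finite direct sums) and idempotent complete (every idempotent splits), and if: (A1) every morphism in $\mathcal C$ has an $n$-kernel; (A1$^{\mathrm{op}}$) every morphism in $\mathcal C$ has an $n$-cokernel; (A2) for every monomorphism $f\colon X\to Y$ in $\mathcal C$ and every $n$-cokernel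 $Y\xrightarrow{g_1}Y_1\to\cdots\xrightarrow{g_n}Y_n$ of $f$, the sequence $X\xrightarrow{f}Y\xrightarrow{g_1}\cdots\xrightarrow{g_{n-1}}Y_{n-1}$ is an $n$-kernel of $g_n$ (where $Y_0=Y$); (A2$^{\mathrm{op}}$) for every epimorphism $f\colon X\to Y$ in $\mathcal C$ and every $n$-kernel $X_n\xrightarrow{f_n}\cdots\xrightarrow{f_1}X$ of $f$, the sequence $X_{n-1}\xrightarrow{f_{n-1}}\cdots\xrightarrow{f_1}X\xrightarrow{f}Y$ is an $n$-cokernel of $f_n$ (where $X_0=X$). -/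

import Mathlib

open CategoryTheory CategoryTheory.Limits

universe v u

namespace HigherAbelian

section Category

variable {C : Type u} [Category.{v} C] [Preadditive C]

/-- A sequence `S₀ ⟶ S₁ ⟶ ⋯ ⟶ Sₙ₊₁` in `C` is left exact if, for every object `W`, the sequence of
abelian groups `0 ⟶ C(W, S₀) ⟶ C(W, S₁) ⟶ ⋯ ⟶ C(W, Sₙ₊₁)` is exact. -/
structure IsLeftExactSeq {n : ℕ} (S : ComposableArrows C (n + 1)) : Prop where
  injective (W : C) : Function.Injective (fun u : W ⟶ S.obj' 0 => u ≫ S.map' 0 1)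
  exact (W : C) (i : ℕ) (hi : i + 2 ≤ n + 1) :
    Function.Exact (fun u : W ⟶ S.obj' i => u ≫ S.map' i (i + 1))
      (fun u : W ⟶ S.obj' (i + 1) => u ≫ S.map' (i + 1) (i + 2))

/-- A sequence `S₀ ⟶ S₁ ⟶ ⋯ ⟶ Sₙ₊₁` in `C` is right exact if, for every object `W`, the sequence
of abelian groups `0 ⟶ C(Sₙ₊₁, W) ⟶ ⋯ ⟶ C(S₁, W) ⟶ C(S₀, W)` is exact. -/
structure IsRightExactSeq {n : ℕ} (S : ComposableArrows C (n + 1)) : Prop where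
  injective (W : C) : Function.Injective (fun u : S.obj' (n + 1) ⟶ W => S.map' n (n + 1) ≫ u)
  exact (W : C) (i : ℕ) (hi : i + 2 ≤ n + 1) :
    Function.Exact (fun u : S.obj' (i + 2) ⟶ W => S.map' (i + 1) (i + 2) ≫ u)
      (fun u : S.obj' (i + 1) ⟶ W => S.map' i (i + 1) ≫ u)

/-- The sequence `S`, written `Xₙ ⟶ ⋯ ⟶ X₁ ⟶ X ⟶ Y`, has `f : X ⟶ Y` as its last morphism, and its
first `n` morphisms `Xₙ ⟶ ⋯ ⟶ X₁ ⟶ X` form an `n`-kernel of `f`. -/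
def IsNKernel {n : ℕ} (S : ComposableArrows C (n + 1)) {X Y : C} (f : X ⟶ Y) : Prop :=
  Arrow.mk (S.map' n (n + 1)) = Arrow.mk f ∧ IsLeftExactSeq S

/-- The sequence `S`, written `X ⟶ Y ⟶ Y₁ ⟶ ⋯ ⟶ Yₙ`, has `f : X ⟶ Y` as its first morphism, and its
last `n` morphisms `Y ⟶ Y₁ ⟶ ⋯ ⟶ Yₙ` form an `n`-cokernel of `f`. -/
def IsNCokernel {n : ℕ} (S : ComposableArrows C (n + 1)) {X Y : C} (f : X ⟶ Y) : Prop :=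
  Arrow.mk (S.map' 0 1) = Arrow.mk f ∧ IsRightExactSeq S

variable (C)

/-- A preadditive category `C` is `n`-abelian (for `n ≥ 1`) if it is additive and idempotent
complete, every morphism has an `n`-kernel and an `n`-cokernel, every monomorphism together with
any of its `n`-cokernels is an `n`-kernel of the last morphism, and dually for epimorphisms. -/
structure IsNAbelian (n : ℕ) : Prop where
  hasZeroObject : HasZeroObject C
  hasFiniteBiproducts : HasFiniteBiproducts C
  isIdempotentComplete : IsIdempotentComplete C
  exists_nKernel {X Y : C} (f : X ⟶ Y) : ∃ S : ComposableArrows C (n + 1), IsNKernel S f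
  exists_nCokernel {X Y : C} (f : X ⟶ Y) : ∃ S : ComposableArrows C (n + 1), IsNCokernel S f
  nKernel_of_mono {X Y : C} (f : X ⟶ Y) (hf : Mono f) (S : ComposableArrows C (n + 1))
    (hS : IsNCokernel S f) : IsNKernel S (S.map' n (n + 1))
  nCokernel_of_epi {X Y : C} (f : X ⟶ Y) (hf : Epi f) (S : ComposableArrows C (n + 1))
    (hS : IsNKernel S f) : IsNCokernel S (S.map' 0 1)

end Category

/-- The property of a `Λ`-module of being finitely generated and projective. -/
def isFGProjective (Λ : Type u) [CommRing Λ] : ObjectProperty (ModuleCat.{u} Λ) :=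
  fun M => Module.Finite Λ M ∧ Module.Projective Λ M

/-- `proj Λ`: the full subcategory of finitely generated projective `Λ`-modules. -/
abbrev FGProj (Λ : Type u) [CommRing Λ] : Type (u + 1) :=
  (isFGProjective Λ).FullSubcategory

/-- A ring is von Neumann regular if for every `x` there is `y` with `x * y * x = x`. -/
def IsVonNeumannRegular (Λ : Type u) [Ring Λ] : Prop :=
  ∀ x : Λ, ∃ y : Λ, x * y * x = x

end HigherAbelian

/-! Suppose `proj Λ` is `n`-abelian. An `n`-kernel of multiplication by `x` is a finite projective
resolution, and the alternating sum `r` of the traces of its identities acts as the rank of the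
ideal `xΛ`. By `IsLeftExactSeq.exists_trace_eq`, `x * r = x` and `r` is killed by the annihilator of
`x`; so `r` is idempotent, `1 - r` generates that annihilator, and `x + (1 - r)` is a
non-zero-divisor. Non-zero-divisors act as morphisms that are mono and epi, which (A2) makes
invertible; the inverse of `x + (1 - r)` is the required `y`.

Conversely, regularity passes from `Λ` to all morphisms: each `f` has a `g` with `fgf = f`.
Splitting idempotents then gives kernels and cokernels, padded by zeros to length `n`, and exactness
becomes a self-dual splitting condition, whence (A2) and its dual. -/

namespace HigherAbelian

/-! ### Traces along exact sequences; zero padding -/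

section Category

variable {C : Type u} [Category.{v} C] [Preadditive C]

lemma IsLeftExactSeq.comp_eq_zero {n : ℕ} {S : ComposableArrows C (n + 1)}
    (hS : IsLeftExactSeq S) (i : ℕ) (hi : i + 2 ≤ n + 1) :
    S.map' i (i + 1) ≫ S.map' (i + 1) (i + 2) = 0 :=
  (hS.exact (S.obj' i) i hi _).2 ⟨𝟙 _, Category.id_comp _⟩

lemma IsRightExactSeq.comp_eq_zero {n : ℕ} {S : ComposableArrows C (n + 1)}
    (hS : IsRightExactSeq S) (i : ℕ) (hi : i + 2 ≤ n + 1) :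
    S.map' i (i + 1) ≫ S.map' (i + 1) (i + 2) = 0 :=
  (hS.exact (S.obj' (i + 2)) i hi _).2 ⟨𝟙 _, Category.comp_id _⟩

/-- Along a left exact sequence in a linear category with a trace, the alternating sum `r` of the
traces of the identities computes traces of partial homotopies: if multiplication by `a`
vanishes on a morphism of the sequence up to a homotopy `g`, then `a * r` is the trace of `g`. -/
theorem IsLeftExactSeq.exists_trace_eq {R : Type*} [CommRing R] [Linear R C]
    (tr : ∀ X : C, (X ⟶ X) →ₗ[R] R)
    (htr : ∀ (X Y : C) (f : X ⟶ Y) (g : Y ⟶ X), tr X (f ≫ g) = tr Y (g ≫ f))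
    {n : ℕ} {S : ComposableArrows C (n + 1)} (hS : IsLeftExactSeq S) (j : ℕ) (hj : j ≤ n) :
    ∃ r : R, ∀ (a : R) (g : S.obj' (j + 1) ⟶ S.obj' j),
      a • S.map' j (j + 1) = S.map' j (j + 1) ≫ g ≫ S.map' j (j + 1) →
        a * r = tr _ (S.map' j (j + 1) ≫ g) := by
  induction j with
  | zero =>
    refine ⟨tr _ (𝟙 (S.obj' 0)), fun a g hg => ?_⟩
    have h : a • 𝟙 (S.obj' 0) = S.map' 0 1 ≫ g :=
      hS.injective _ <| by
        change (a • 𝟙 _) ≫ S.map' 0 1 = (S.map' 0 1 ≫ g) ≫ S.map' 0 1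
        rw [Linear.smul_comp, Category.id_comp, Category.assoc]
        exact hg
    rw [← h, map_smul, smul_eq_mul]
  | succ j ih =>
    obtain ⟨r, hr⟩ := ih (by omega)
    refine ⟨tr _ (𝟙 (S.obj' (j + 1))) - r, fun a g hg => ?_⟩
    -- The defect `a • 𝟙 - d ≫ g` is killed by the next map `d`, so it factors through the previous
    -- one by some `h`. This `h` is a partial homotopy one step down, and cyclicity of the trace
    -- closes the recursion.
    obtain ⟨h, hh⟩ := (hS.exact _ j (by omega)
      (a • 𝟙 _ - S.map' (j + 1) (j + 2) ≫ g)).1 (by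
        simp only [Preadditive.sub_comp, Linear.smul_comp, Category.id_comp, Category.assoc]
        exact sub_eq_zero.2 hg)
    replace hh : h ≫ S.map' j (j + 1) =
      a • 𝟙 _ - S.map' (j + 1) (j + 2) ≫ g := hh
    have h₁ := hr a h (by
      rw [hh, Preadditive.comp_sub, Linear.comp_smul, Category.comp_id,
        reassoc_of% (hS.comp_eq_zero j (by omega)), zero_comp, sub_zero])
    have h₂ := congrArg (tr _) hh
    rw [htr, ← h₁, map_sub, map_smul, smul_eq_mul] at h₂
    rw [mul_sub, h₂, sub_sub_cancel]

/-- In an `n`-abelian category with `n ≥ 1`, a monomorphism which is an epimorphism has a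
section. -/
theorem IsNAbelian.exists_section {n : ℕ} (h : IsNAbelian C n) (hn : 1 ≤ n) {X Y : C} (f : X ⟶ Y)
    [hf : Mono f] [he : Epi f] : ∃ g : Y ⟶ X, g ≫ f = 𝟙 Y := by
  obtain ⟨S, hS⟩ := h.exists_nCokernel f
  have hK := (h.nKernel_of_mono f hf S hS).2
  -- `hS.1` is an equality of arrows, so properties of `f` are moved to the first map of `S` by
  -- quantifying over the arrow.
  have hsec : ∀ φ : Arrow C, φ = Arrow.mk f → (∃ g : φ.right ⟶ φ.left, g ≫ φ.hom = 𝟙 _) →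
      ∃ g : Y ⟶ X, g ≫ f = 𝟙 Y := by
    rintro _ rfl h
    exact h
  have hepi : ∀ φ : Arrow C, φ = Arrow.mk f → Epi φ.hom := by
    rintro _ rfl
    exact he
  refine hsec _ hS.1 ?_
  have : Epi (S.map' 0 1) := hepi _ hS.1
  -- As `f` is epi, the map after it vanishes; then `𝟙 Y` is killed by that map and so factors
  -- through `f`.
  have h0 : S.map' 1 2 (by omega) (by omega) = 0 :=
    (cancel_epi _).1 ((hK.comp_eq_zero 0 (by omega)).trans comp_zero.symm)
  exact (hK.exact (S.obj' 1) 0 (by omega) (𝟙 _)).1 ((Category.id_comp _).trans h0)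

theorem IsNKernel.precomp_zero {n : ℕ} {S : ComposableArrows C (n + 1)} {X Y : C}
    {f : X ⟶ Y} (hS : IsNKernel S f) {Z : C} (hZ : IsZero Z) :
    IsNKernel (S.precomp (0 : Z ⟶ S.left)) f := by
  refine ⟨hS.1, ⟨fun W u v _ => hZ.eq_of_tgt u v, ?_⟩⟩
  rintro W (_ | i) hi u
  · constructor
    · intro hu
      have h0 : u = 0 := hS.2.injective W (hu.trans zero_comp.symm)
      exact ⟨0, zero_comp.trans h0.symm⟩
    · rintro ⟨w, rfl⟩
      have h0 (w : W ⟶ Z) : (w ≫ (0 : Z ⟶ S.left)) ≫ S.map' 0 1 = 0 := by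
        rw [comp_zero, zero_comp]
      exact h0 w
  · exact hS.2.exact W i (by omega) u

theorem exists_nKernel_of_kernel [HasZeroObject C] {K X Y : C} (k : K ⟶ X) (f : X ⟶ Y)
    (hk : ∀ W : C, Function.Injective fun u : W ⟶ K => u ≫ k)
    (hkf : ∀ W : C, Function.Exact (fun u : W ⟶ K => u ≫ k) (fun u : W ⟶ X => u ≫ f))
    {n : ℕ} (hn : 1 ≤ n) : ∃ S : ComposableArrows C (n + 1), IsNKernel S f := by
  induction n, hn using Nat.le_induction with
  | base =>
    refine ⟨ComposableArrows.mk₂ k f, rfl, ⟨hk, fun W i hi => ?_⟩⟩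
    obtain rfl : i = 0 := by omega
    exact hkf W
  | succ n hn ih =>
    obtain ⟨S, hS⟩ := ih
    exact ⟨_, hS.precomp_zero (isZero_zero C)⟩

open scoped ZeroObject in
theorem exists_nCokernel_of_cokernel [HasZeroObject C] {X Y Q : C} (f : X ⟶ Y) (q : Y ⟶ Q)
    (hq : ∀ W : C, Function.Injective fun u : Q ⟶ W => q ≫ u)
    (hqf : ∀ W : C, Function.Exact (fun u : Q ⟶ W => q ≫ u) (fun u : Y ⟶ W => f ≫ u))
    {n : ℕ} (hn : 1 ≤ n) : ∃ S : ComposableArrows C (n + 1), IsNCokernel S f := by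
  -- The zeros go at the far end, so the sequence is defined on all of `ℕ` and cut to its first `n +
  -- 2` objects.
  let obj : ℕ → C := fun i => match i with
    | 0 => X
    | 1 => Y
    | 2 => Q
    | _ + 3 => 0
  let d : ∀ i, obj i ⟶ obj (i + 1) := fun i => match i with
    | 0 => f
    | 1 => q
    | 2 => 0
    | _ + 3 => 0
  let S : ComposableArrows C (n + 1) :=
    (Monotone.functor (f := fun i : Fin (n + 2) => (i : ℕ)) fun _ _ h => h) ⋙
      Functor.ofSequence d
  have hS (i : ℕ) (hi : i + 1 ≤ n + 1) : S.map' i (i + 1) = d i :=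
    Functor.ofSequence_map_homOfLE_succ d i
  have hzero (i : ℕ) (hi : 3 ≤ i) : IsZero (obj i) := by
    obtain ⟨i, rfl⟩ := Nat.exists_eq_add_of_le' hi
    exact isZero_zero C
  refine ⟨S, congrArg Arrow.mk (hS 0 (by omega)), ⟨fun W => ?_, fun W i hi => ?_⟩⟩
  · rw [hS n le_rfl]
    obtain rfl | hn' := hn.eq_or_lt
    · exact hq W
    · exact fun u v _ => (hzero (n + 1) (by omega)).eq_of_src u v
  · rw [hS i (by omega), hS (i + 1) hi]
    match i with
    | 0 => exact hqf W
    | 1 =>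
      intro u
      constructor
      · intro hu
        have h0 : u = 0 := hq W (hu.trans comp_zero.symm)
        exact ⟨0, comp_zero.trans h0.symm⟩
      · rintro ⟨w, rfl⟩
        have h0 (w : (0 : C) ⟶ W) : q ≫ (0 : Q ⟶ (0 : C)) ≫ w = 0 := by rw [zero_comp, comp_zero]
        exact h0 w
    | i + 2 =>
      intro u
      obtain rfl : u = 0 := (hzero (i + 3) (by omega)).eq_of_src _ _
      exact ⟨fun _ => ⟨0, comp_zero⟩, fun _ => comp_zero⟩

end Category

/-! ### Categories whose morphisms are all regular -/

section Regular

variable {C : Type u} [Category.{v} C] [Preadditive C]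

/-- If `d ≫ r ≫ d = d`, then `𝟙 - r ≫ d` is killed by `d`, so right exactness factors it through the
next map. Any `u` killed by that next map therefore equals `u ≫ r ≫ d`. Only injectivity at the left
end needs the monomorphism. -/
theorem IsRightExactSeq.isLeftExactSeq {n : ℕ} {S : ComposableArrows C (n + 1)}
    (hS : IsRightExactSeq S) (hreg : ∀ {X Y : C} (f : X ⟶ Y), ∃ g : Y ⟶ X, f ≫ g ≫ f = f)
    [Mono (S.map' 0 1)] : IsLeftExactSeq S where
  injective W u v h := (cancel_mono _).1 h
  exact W i hi u := by
    constructor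
    · intro hu
      replace hu : u ≫ S.map' (i + 1) (i + 2) = 0 := hu
      obtain ⟨r, hr⟩ := hreg (S.map' i (i + 1))
      obtain ⟨t, ht⟩ := (hS.exact (S.obj' (i + 1)) i hi (𝟙 _ - r ≫ S.map' i (i + 1))).1
        (show S.map' i (i + 1) ≫ (𝟙 _ - r ≫ S.map' i (i + 1)) = 0 by
          rw [Preadditive.comp_sub, hr, Category.comp_id, sub_self])
      replace ht : S.map' (i + 1) (i + 2) ≫ t = 𝟙 _ - r ≫ S.map' i (i + 1) := ht
      refine ⟨u ≫ r, ?_⟩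
      have h := congrArg (u ≫ ·) ht
      simp only [reassoc_of% hu, zero_comp, Preadditive.comp_sub, Category.comp_id] at h
      exact (Category.assoc _ _ _).trans (sub_eq_zero.1 h.symm).symm
    · rintro ⟨w, rfl⟩
      change (w ≫ S.map' i (i + 1)) ≫ S.map' (i + 1) (i + 2) = 0
      rw [Category.assoc, hS.comp_eq_zero i hi, comp_zero]

theorem IsLeftExactSeq.isRightExactSeq {n : ℕ} {S : ComposableArrows C (n + 1)}
    (hS : IsLeftExactSeq S) (hreg : ∀ {X Y : C} (f : X ⟶ Y), ∃ g : Y ⟶ X, f ≫ g ≫ f = f)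
    [Epi (S.map' n (n + 1))] : IsRightExactSeq S where
  injective W u v h := (cancel_epi _).1 h
  exact W i hi u := by
    constructor
    · intro hu
      replace hu : S.map' i (i + 1) ≫ u = 0 := hu
      obtain ⟨r, hr⟩ := hreg (S.map' (i + 1) (i + 2))
      obtain ⟨t, ht⟩ := (hS.exact (S.obj' (i + 1)) i hi (𝟙 _ - S.map' (i + 1) (i + 2) ≫ r)).1
        (show (𝟙 _ - S.map' (i + 1) (i + 2) ≫ r) ≫ S.map' (i + 1) (i + 2) = 0 by
          rw [Preadditive.sub_comp, Category.assoc, hr, Category.id_comp, sub_self])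
      replace ht : t ≫ S.map' i (i + 1) = 𝟙 _ - S.map' (i + 1) (i + 2) ≫ r := ht
      refine ⟨r ≫ u, ?_⟩
      have h := congrArg (· ≫ u) ht
      simp only [Category.assoc, hu, comp_zero, Preadditive.sub_comp, Category.id_comp] at h
      exact (sub_eq_zero.1 h.symm).symm
    · rintro ⟨w, rfl⟩
      change S.map' i (i + 1) ≫ S.map' (i + 1) (i + 2) ≫ w = 0
      rw [reassoc_of% (hS.comp_eq_zero i hi), zero_comp]

/-- An additive idempotent complete category all of whose morphisms are von Neumann regular is
`n`-abelian for every `n ≥ 1`. -/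
theorem isNAbelian_of_regular [HasZeroObject C] [HasFiniteBiproducts C] [IsIdempotentComplete C]
    (hreg : ∀ {X Y : C} (f : X ⟶ Y), ∃ g : Y ⟶ X, f ≫ g ≫ f = f) {n : ℕ} (hn : 1 ≤ n) :
    IsNAbelian C n where
  hasZeroObject := inferInstance
  hasFiniteBiproducts := inferInstance
  isIdempotentComplete := inferInstance
  exists_nKernel {X Y} f := by
    obtain ⟨g, hg⟩ := hreg f
    obtain ⟨K, k, p, hkp, hpk⟩ := IsIdempotentComplete.idempotents_split X (𝟙 X - f ≫ g)
      (Idempotents.idem_of_id_sub_idem _ (by rw [Category.assoc, reassoc_of% hg]))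
    have hkf : k ≫ f = 0 := by
      have : (k ≫ p) ≫ k ≫ f = k ≫ (p ≫ k) ≫ f := by simp
      rw [hkp, hpk, Category.id_comp] at this
      simp [this, hg]
    refine exists_nKernel_of_kernel k f (fun W u v huv => ?_) (fun W u => ⟨fun hu => ?_, ?_⟩) hn
    · simpa [hkp] using congrArg (· ≫ p) huv
    · refine ⟨u ≫ p, ?_⟩
      change u ≫ f = 0 at hu
      simp [hpk, reassoc_of% hu]
    · rintro ⟨w, rfl⟩
      simp [hkf]
  exists_nCokernel {X Y} f := by
    obtain ⟨g, hg⟩ := hreg f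
    obtain ⟨Q, i, q, hiq, hqi⟩ := IsIdempotentComplete.idempotents_split Y (𝟙 Y - g ≫ f)
      (Idempotents.idem_of_id_sub_idem _ (by rw [Category.assoc, hg]))
    have hfq : f ≫ q = 0 := by
      have : (f ≫ q) ≫ i ≫ q = f ≫ (q ≫ i) ≫ q := by simp
      rw [hiq, hqi, Category.comp_id, Preadditive.sub_comp, Preadditive.comp_sub,
        Category.id_comp, Category.assoc, reassoc_of% hg, sub_self] at this
      exact this
    refine exists_nCokernel_of_cokernel f q (fun W u v huv => ?_) (fun W u => ⟨fun hu => ?_, ?_⟩) hn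
    · simpa [reassoc_of% hiq] using congrArg (i ≫ ·) huv
    · refine ⟨i ≫ u, ?_⟩
      change f ≫ u = 0 at hu
      simp [reassoc_of% hqi, hu]
    · rintro ⟨w, rfl⟩
      simp [reassoc_of% hfq]
  nKernel_of_mono {X Y} f hf S hS := by
    have hmono : ∀ φ : Arrow C, φ = Arrow.mk f → Mono φ.hom := by
      rintro _ rfl
      exact hf
    have : Mono (S.map' 0 1) := hmono _ hS.1
    exact ⟨rfl, hS.2.isLeftExactSeq hreg⟩
  nCokernel_of_epi {X Y} f hf S hS := by
    have hepi : ∀ φ : Arrow C, φ = Arrow.mk f → Epi φ.hom := by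
      rintro _ rfl
      exact hf
    have : Epi (S.map' n (n + 1)) := hepi _ hS.1
    exact ⟨rfl, hS.2.isRightExactSeq hreg⟩

end Regular

/-! ### Trace on finitely generated projective modules -/

section Trace

variable (R : Type*) [CommRing R] (M N : Type*) [AddCommGroup M] [Module R M] [Module.Finite R M]
  [Module.Projective R M] [AddCommGroup N] [Module R N] [Module.Finite R N] [Module.Projective R N]

/-- The trace of an endomorphism of a finitely generated projective module. -/
noncomputable def projTrace : (M →ₗ[R] M) →ₗ[R] R :=
  contractLeft R M ∘ₗ (dualTensorHomEquiv R M M).symm.toLinearMap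

variable {R M N}

lemma projTrace_dualTensorHom (t : TensorProduct R (Module.Dual R M) M) :
    projTrace R M (dualTensorHom R M M t) = contractLeft R M t :=
  congrArg (contractLeft R M) ((dualTensorHomEquiv R M M).symm_apply_apply t)

theorem projTrace_comp_comm (f : M →ₗ[R] N) (g : N →ₗ[R] M) :
    projTrace R M (g ∘ₗ f) = projTrace R N (f ∘ₗ g) := by
  obtain ⟨s, rfl⟩ := dualTensorHom_bijective.2 f
  obtain ⟨t, rfl⟩ := dualTensorHom_bijective.2 g
  induction s with
  | zero => simp
  | add s₁ s₂ h₁ h₂ => simp only [map_add, LinearMap.comp_add, LinearMap.add_comp, h₁, h₂]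
  | tmul φ y =>
    induction t with
    | zero => simp
    | add t₁ t₂ h₁ h₂ => simp only [map_add, LinearMap.comp_add, LinearMap.add_comp, h₁, h₂]
    | tmul ψ x =>
      simp only [comp_dualTensorHom, map_smul, projTrace_dualTensorHom, contractLeft_apply,
        smul_eq_mul, mul_comm]

lemma projTrace_id_self : projTrace R R LinearMap.id = 1 := by
  have h : (LinearMap.id : R →ₗ[R] R) = dualTensorHom R R R (LinearMap.id ⊗ₜ[R] 1) := by
    ext
    simp
  rw [h, projTrace_dualTensorHom, contractLeft_apply, LinearMap.id_apply]

end Trace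

/-! ### Modules over von Neumann regular rings -/

section VonNeumann

variable {R : Type*} [CommRing R]

/-- Over a von Neumann regular ring, every element of a finitely generated projective module is
fixed by one of its images under the dual. -/
theorem IsVonNeumannRegular.exists_dual_smul_eq (hR : IsVonNeumannRegular R) {N : Type*}
    [AddCommGroup N] [Module R N] [Module.Finite R N] [Module.Projective R N] (x : N) :
    ∃ φ : Module.Dual R N, φ x • x = x := by
  -- `I` consists of all values `φ x`. It is finitely generated, and idempotent by regularity, so an
  -- idempotent `e = φ x` generates it. Then `e` fixes every `ψ x`, and functionals separate points.
  let I : Ideal R := LinearMap.range (LinearMap.applyₗ x : Module.Dual R N →ₗ[R] R)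
  have hI : IsIdempotentElem I := by
    refine le_antisymm Ideal.mul_le_left fun a ha => ?_
    obtain ⟨b, hb⟩ := hR a
    rw [← hb]
    exact Ideal.mul_mem_mul (I.mul_mem_right b ha) ha
  obtain ⟨e, he, hIe⟩ := (Ideal.isIdempotentElem_iff_of_fg I
    (Module.Finite.iff_fg.1 (Module.Finite.range _))).1 hI
  obtain ⟨φ, hφ⟩ : e ∈ I := hIe ▸ Submodule.mem_span_singleton_self e
  refine ⟨φ, ?_⟩
  rw [← sub_eq_zero, ← Module.forall_dual_apply_eq_zero_iff R]
  intro ψ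
  obtain ⟨c, hc⟩ : ∃ c : R, c • e = ψ x :=
    Submodule.mem_span_singleton.1 (hIe ▸ ⟨ψ, rfl⟩ : ψ x ∈ Submodule.span R {e})
  have hφ' : φ x = e := hφ
  rw [map_sub, map_smul, hφ', ← hc, smul_eq_mul, smul_eq_mul, mul_left_comm, he.eq, sub_self]

theorem IsVonNeumannRegular.exists_projection (hR : IsVonNeumannRegular R) {N : Type*}
    [AddCommGroup N] [Module R N] [Module.Finite R N] [Module.Projective R N]
    (K : Submodule R N) (hK : K.FG) :
    ∃ p : N →ₗ[R] N, (∀ v, p v ∈ K) ∧ ∀ v ∈ K, p v = v := by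
  -- Induction on generators needs the claim for all images of `K`: in the sum step, the hypothesis
  -- on `K₂` is applied to its image under `(1 - p₁) ∘ q`.
  suffices h : ∀ q : N →ₗ[R] N, ∃ p : N →ₗ[R] N,
      (∀ v, p v ∈ K.map q) ∧ ∀ v ∈ K, p (q v) = q v by
    simpa using h LinearMap.id
  induction K, hK using Submodule.fg_induction
  case _ x =>
    intro q
    obtain ⟨φ, hφ⟩ := hR.exists_dual_smul_eq (q x)
    refine ⟨φ.smulRight (q x), fun v => ⟨φ v • x, ?_, by simp⟩, fun v hv => ?_⟩
    · exact Submodule.smul_mem _ _ (Submodule.mem_span_singleton_self x)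
    · obtain ⟨c, rfl⟩ := Submodule.mem_span_singleton.1 hv
      simp [hφ]
  case _ K₁ K₂ _ _ h₁ h₂ =>
    intro q
    obtain ⟨p₁, hp₁, hp₁'⟩ := h₁ q
    obtain ⟨p₂, hp₂, hp₂'⟩ := h₂ ((LinearMap.id - p₁) ∘ₗ q)
    rw [Submodule.map_sup]
    refine ⟨p₁ + p₂ ∘ₗ (LinearMap.id - p₁), fun v => ?_, fun v hv => ?_⟩
    · refine add_mem (Submodule.mem_sup_left (hp₁ v)) ?_
      obtain ⟨w, hw, hw'⟩ := hp₂ ((LinearMap.id - p₁ : N →ₗ[R] N) v)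
      rw [LinearMap.comp_apply, ← hw']
      exact sub_mem (Submodule.mem_sup_right ⟨w, hw, rfl⟩) (Submodule.mem_sup_left (hp₁ _))
    · obtain ⟨a, ha, b, hb, rfl⟩ := Submodule.mem_sup.1 hv
      have hb' := hp₂' b hb
      simp only [LinearMap.comp_apply, LinearMap.sub_apply, LinearMap.id_apply] at hb'
      simp only [map_add, LinearMap.add_apply, LinearMap.comp_apply, LinearMap.sub_apply,
        LinearMap.id_apply, hp₁' a ha, hb', sub_self, map_zero]
      abel

/-- Lift a projection of `N` onto the range of `f` through the surjection from `M`, using that `N`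
is projective. -/
theorem IsVonNeumannRegular.exists_comp_comp_eq (hR : IsVonNeumannRegular R) {M N : Type*}
    [AddCommGroup M] [Module R M] [Module.Finite R M]
    [AddCommGroup N] [Module R N] [Module.Finite R N] [Module.Projective R N]
    (f : M →ₗ[R] N) : ∃ g : N →ₗ[R] M, f ∘ₗ g ∘ₗ f = f := by
  obtain ⟨p, hp, hp'⟩ := hR.exists_projection (LinearMap.range f)
    (Module.Finite.iff_fg.1 (Module.Finite.range f))
  obtain ⟨g, hg⟩ := Module.projective_lifting_property f.rangeRestrict (p.codRestrict _ hp)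
    f.surjective_rangeRestrict
  refine ⟨g, LinearMap.ext fun v => ?_⟩
  have h := congrArg Subtype.val (LinearMap.congr_fun hg (f v))
  exact h.trans (hp' _ ⟨v, rfl⟩)

end VonNeumann

/-! ### The category `proj Λ` -/

section FGProj

variable {Λ : Type u} [CommRing Λ]

instance (X : FGProj Λ) : Module.Finite Λ X.obj := X.property.1

instance (X : FGProj Λ) : Module.Projective Λ X.obj := X.property.2

/-- A finitely generated projective module, as an object of `FGProj Λ`. -/
abbrev FGProj.of (M : Type u) [AddCommGroup M] [Module Λ M] [Module.Finite Λ M]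
    [Module.Projective Λ M] : FGProj Λ :=
  ⟨ModuleCat.of Λ M, ‹_›, ‹_›⟩

/-- Linear maps between finitely generated projective modules, as morphisms of `FGProj Λ`. -/
def FGProj.homLinearEquiv (X Y : FGProj Λ) : (X ⟶ Y) ≃ₗ[Λ] (X.obj →ₗ[Λ] Y.obj) where
  toFun f := f.hom.hom
  invFun f := ObjectProperty.homMk (ModuleCat.ofHom f)
  map_add' _ _ := rfl
  map_smul' _ _ := rfl
  left_inv _ := rfl
  right_inv _ := rfl

/-- A linear map, as a morphism of `FGProj Λ`. -/
abbrev FGProj.ofHom {X Y : FGProj Λ} (f : X.obj →ₗ[Λ] Y.obj) : X ⟶ Y :=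
  ObjectProperty.homMk (ModuleCat.ofHom f)

lemma FGProj.hom_ext {X Y : FGProj Λ} {f g : X ⟶ Y} (h : f.hom.hom = g.hom.hom) : f = g :=
  (FGProj.homLinearEquiv X Y).injective h

instance : HasZeroObject (FGProj Λ) where
  zero := by
    refine ⟨FGProj.of PUnit, (IsZero.iff_id_eq_zero _).2 (FGProj.hom_ext ?_)⟩
    ext

instance : HasFiniteBiproducts (FGProj Λ) where
  out n := ⟨fun F => by
    have : Module.Projective Λ (∀ i, (F i).obj) :=
      .of_equiv (DirectSum.linearEquivFunOnFintype Λ (Fin n) fun i => (F i).obj)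
    let b : Bicone F :=
      { pt := FGProj.of (∀ i, (F i).obj)
        π := fun i => FGProj.ofHom (LinearMap.proj i)
        ι := fun i => FGProj.ofHom (LinearMap.single Λ (fun i => (F i).obj) i)
        ι_π := fun i j => FGProj.hom_ext <| by
          split_ifs with h
          · subst h
            exact LinearMap.proj_comp_single_same Λ (fun i => (F i).obj) i
          · exact LinearMap.proj_comp_single_ne Λ (fun i => (F i).obj) j i (Ne.symm h) }
    refine hasBiproduct_of_total b ?_
    refine (FGProj.homLinearEquiv _ _).injective ?_
    rw [map_sum]
    exact LinearMap.ext fun x =>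
      (LinearMap.sum_apply ..).trans (Finset.univ_sum_single (M := fun i => (F i).obj) x)⟩

instance : IsIdempotentComplete (FGProj Λ) where
  idempotents_split X p hp := by
    let f : X.obj →ₗ[Λ] X.obj := p.hom.hom
    have hf : ∀ x, f (f x) = f x := fun x =>
      LinearMap.congr_fun (congrArg (FGProj.homLinearEquiv X X) hp) x
    have hsplit : f.rangeRestrict ∘ₗ (LinearMap.range f).subtype = LinearMap.id := by
      ext ⟨_, x, rfl⟩
      exact hf x
    have : Module.Projective Λ (LinearMap.range f) := .of_split _ _ hsplit
    exact ⟨FGProj.of (LinearMap.range f), FGProj.ofHom (LinearMap.range f).subtype,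
      FGProj.ofHom f.rangeRestrict, FGProj.hom_ext hsplit, rfl⟩

/-- Multiplication by `a`, as an endomorphism of `Λ` in `FGProj Λ`. -/
abbrev FGProj.mulHom (a : Λ) : FGProj.of (Λ := Λ) Λ ⟶ FGProj.of Λ :=
  a • 𝟙 _

/-- The trace identity is used twice: with `a = x` and `g` the identity, then with `a` annihilating
`x` and `g = 0`. -/
theorem exists_mul_of_isNAbelian {n : ℕ} (h : IsNAbelian (FGProj Λ) n) (x : Λ) :
    ∃ r : Λ, x * r = x ∧ ∀ a : Λ, a * x = 0 → a * r = 0 := by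
  obtain ⟨S, hS⟩ := h.exists_nKernel (FGProj.mulHom x)
  let tr : ∀ X : FGProj Λ, (X ⟶ X) →ₗ[Λ] Λ := fun X =>
    projTrace Λ X.obj ∘ₗ (FGProj.homLinearEquiv X X).toLinearMap
  have key : ∀ φ : Arrow (FGProj Λ), φ = Arrow.mk (FGProj.mulHom x) →
      (∃ r : Λ, ∀ (a : Λ) (g : φ.right ⟶ φ.left), a • φ.hom = φ.hom ≫ g ≫ φ.hom →
        a * r = tr _ (φ.hom ≫ g)) →
      ∃ r : Λ, x * r = x ∧ ∀ a : Λ, a * x = 0 → a * r = 0 := by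
    rintro _ rfl ⟨r, hr⟩
    refine ⟨r, (hr x (𝟙 _) ?_).trans ?_, fun a ha => (hr a 0 ?_).trans ?_⟩
    · simp [FGProj.mulHom]
    · change tr _ (FGProj.mulHom x ≫ 𝟙 _) = x
      rw [Category.comp_id, map_smul]
      exact (congrArg (x * ·) projTrace_id_self).trans (mul_one x)
    · simp [FGProj.mulHom, smul_smul, ha]
    · simp
  exact key _ hS.1 (hS.2.exists_trace_eq tr
    (fun X Y f g => projTrace_comp_comm (M := X.obj) (N := Y.obj) f.hom.hom g.hom.hom) n le_rfl)

/-- Projectives are flat, so `x` acts injectively on every object; hence multiplication by `x` is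
both mono and epi. A section of it, evaluated at `1`, inverts `x`. -/
theorem isUnit_of_isNAbelian {n : ℕ} (h : IsNAbelian (FGProj Λ) n) (hn : 1 ≤ n) {x : Λ}
    (hx : x ∈ nonZeroDivisors Λ) : IsUnit x := by
  have hreg (X : FGProj Λ) : IsSMulRegular X.obj x :=
    Module.Flat.isSMulRegular_of_nonZeroDivisors hx
  have : Mono (FGProj.mulHom x) := ⟨fun {Z} u v huv => FGProj.hom_ext <| LinearMap.ext fun z =>
    hreg _ <| by
      rw [Linear.comp_smul, Linear.comp_smul, Category.comp_id, Category.comp_id] at huv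
      exact LinearMap.congr_fun (congrArg (FGProj.homLinearEquiv _ _) huv) z⟩
  have : Epi (FGProj.mulHom x) := ⟨fun {Z} u v huv => FGProj.hom_ext <| LinearMap.ext fun z =>
    hreg _ <| by
      rw [Linear.smul_comp, Linear.smul_comp, Category.id_comp, Category.id_comp] at huv
      exact LinearMap.congr_fun (congrArg (FGProj.homLinearEquiv _ _) huv) z⟩
  obtain ⟨g, hg⟩ := h.exists_section hn (FGProj.mulHom x)
  rw [Linear.comp_smul, Category.comp_id] at hg
  exact .of_mul_eq_one (g.hom.hom (1 : Λ))
    (LinearMap.congr_fun (congrArg (FGProj.homLinearEquiv _ _) hg) (1 : Λ))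

theorem isVonNeumannRegular_of_isNAbelian {n : ℕ} (h : IsNAbelian (FGProj Λ) n) (hn : 1 ≤ n) :
    IsVonNeumannRegular Λ := by
  intro x
  obtain ⟨r, hxr, hr⟩ := exists_mul_of_isNAbelian h x
  have hrr : (1 - r) * r = 0 := hr _ (by linear_combination -hxr)
  have hu : x + (1 - r) ∈ nonZeroDivisors Λ := by
    refine mem_nonZeroDivisors_iff_right.2 fun z hz => ?_
    -- Multiplying by `r` removes the summand `1 - r` and fixes `x`.
    have hzx : z * x = 0 := by linear_combination r * hz - z * hxr - z * hrr
    linear_combination hz - hzx + hr z hzx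
  obtain ⟨y, hy⟩ := (isUnit_of_isNAbelian h hn hu).exists_right_inv
  refine ⟨y, ?_⟩
  -- Since `x * (1 - r) = 0`, multiplying `(x + (1 - r)) * y = 1` by `x` leaves `x * x * y = x`.
  linear_combination x * hy + y * hxr

theorem isNAbelian_of_isVonNeumannRegular (h : IsVonNeumannRegular Λ) {n : ℕ} (hn : 1 ≤ n) :
    IsNAbelian (FGProj Λ) n :=
  isNAbelian_of_regular (fun {X Y} f => by
    obtain ⟨g, hg⟩ := h.exists_comp_comp_eq (M := X.obj) (N := Y.obj) f.hom.hom
    exact ⟨FGProj.ofHom g, FGProj.hom_ext hg⟩) hn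

end FGProj

end HigherAbelian

theorem proposition17 (Λ : Type u) [CommRing Λ] (n : ℕ) (hn : 1 ≤ n) :
    HigherAbelian.IsNAbelian (HigherAbelian.FGProj Λ) n ↔
      HigherAbelian.IsVonNeumannRegular Λ :=
  ⟨fun h => HigherAbelian.isVonNeumannRegular_of_isNAbelian h hn,
    fun h => HigherAbelian.isNAbelian_of_isVonNeumannRegular h hn⟩
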